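/- There is a universal constant $C>0$ such that the following holds. Let $\mathcal X\subset\mathbb R^d$ be measurable, let $\rho$ be a probability density on $\mathcal X$, and write $\|g\|_{2,\rho}^2=\int g(x)^2\rho(x)\,dx$. Let $K$ be a positive definite correlation function on $\mathcal X$ (so $K(x,x)=1$), with $L^2_\rho$-orthonormal eigenfunctions $(\phi_j)_{j\ge1}$ and eigenvalues $\lambda_j\ge 0$, that is, $\int K(x,x')\phi_j(x')\rho(x')\,dx'=\lambda_j\phi_j(x)$ for all $x \in \mathcal X$ and $j\ge1$. Let $\sigma>0$, let $f_0:\mathcal X\to\mathbb R$, let $n,k_n$ be nonnegative integers, let $X_1,\dots,X_n$ be i.i.d. with density $\rho$, and let $Y_i=f_0(X_i)+\varepsilon_i$ with $\varepsilon_i$ i.i.d. $\mathrm N(0,\sigma^2)$, independent of the $X_i$; $\mathbb E_0$ is the expectation under this law of $(X,Y)$. Put $\theta_{0j}=\int f_0\phi_j\rho\,dx$, $\theta_0^t=(\theta_{01},\dots,\theta_{0k_n})$, $f_0^t=\sum_{j\le k_n}\theta_{0j}\phi_j$, $\Lambda=\mathrm{diag}(\lambda_1,\dots,\lambda_{k_n})$,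 $\|\theta_0^t\|_{\mathbb H}^2=\sum_{j\le k_n}\theta_{0j}^2/\lambda_j$, and $\Phi=(\phi_j(X_i))_{i\le n,\,j\le k_n}$. Assume (T1) $f_0\in L^2_\rho(\mathcal X)$ and $\|f_0-\sum_{j\le J}\theta_{0j}\phi_j\|_{2,\rho}\to0$ as $J\to\infty$; (A1) $\lambda_1,\dots,\lambda_{k_n}>0$ and $\|\Lambda^{-1}\|_2<n/4$; (A2) for some real $L_n$, $\sup_{x\in\mathcal X}|\phi_j(x)|\le L_n$ for $j\le k_n$, and $L_n^2k_n\log k_n<n$ (with $k_n \log k_n = 0$ for $k_n = 0$). Let $\widetilde{\mathcal W}^t(\cdot\mid Y,X)=\mathrm N(\widetilde\theta,\widetilde\Sigma)$, with $\widetilde\theta=(\Phi^{\mathsf T}\Phi+\Lambda^{-1})^{-1}\Phi^{\mathsf T}Y$ and $\widetilde\Sigma=\sigma^2(\Phi^{\mathsf T}\Phi+\Lambda^{-1})^{-1}$, be the truncated Gaussian process (tGP) posterior, i.e. the posterior of $\theta$ in the model $Y\sim \mathrm N(\Phi\theta,\sigma^2\mathrm I_n)$, $\theta\sim\mathrm N(0,\sigma^2\Lambda)$.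 Let $A_n=\{\|\Phi^{\mathsf T}\Phi-n\mathrm I_{k_n}\|_2<n/2\}$, where $\|\cdot\|_2$ is the operator norm, and let $d_{W,2}(P,Q)=\inf(\mathbb E\|U-V\|^2)^{1/2}$, the infimum being over all couplings $(U,V)$ of $P$ and $Q$. Then $$\mathbb E_0\Big\{\mathbb 1_{A_n}(X)\,d_{W,2}^2\Big[\widetilde{\mathcal W}^t(\cdot\mid Y,X),\ \mathrm N_{k_n}\big(\theta_0^t,\tfrac{\sigma^2}{n}\mathrm I_{k_n}\big)\Big]\Big\}\le C\Big(\sigma^2\frac{k_n}{n}+\frac{\|\theta_0^t\|_{\mathbb H}^2}{n}+\|f_0-f_0^t\|_{2,\rho}^2\Big).$$ -/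

import Mathlib

open MeasureTheory ProbabilityTheory Filter Topology
open scoped ENNReal NNReal Matrix

noncomputable section

namespace TGP

/-- The `L^p` Wasserstein distance between two measures on `ℝᵏ` with respect to the Euclidean
metric: the infimum of `(E ‖U - V‖^p)^(1/p)` over all couplings of `P` and `Q`. -/
def wasserstein {k : ℕ} (p : ℝ) (P Q : Measure (EuclideanSpace ℝ (Fin k))) : ℝ≥0∞ :=
  ⨅ (γ : Measure (EuclideanSpace ℝ (Fin k) × EuclideanSpace ℝ (Fin k)))
    (_ : γ.map Prod.fst = P) (_ : γ.map Prod.snd = Q),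
    (∫⁻ z, (‖z.1 - z.2‖ₑ) ^ p ∂γ) ^ (1 / p)

/-- The operator norm of a square real matrix with respect to the Euclidean norm. -/
def opNorm {k : ℕ} (A : Matrix (Fin k) (Fin k) ℝ) : ℝ :=
  ‖Matrix.toEuclideanCLM (n := Fin k) (𝕜 := ℝ) A‖

variable {d : ℕ}

/-- `ρ` is a probability density on the measurable set `𝒳 ⊆ ℝᵈ`. -/
structure IsDensityOn (𝒳 : Set (EuclideanSpace ℝ (Fin d)))
    (ρ : EuclideanSpace ℝ (Fin d) → ℝ) : Prop where
  measurableSet : MeasurableSet 𝒳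
  measurable : Measurable ρ
  nonneg : ∀ x ∈ 𝒳, 0 ≤ ρ x
  lintegral_eq_one : ∫⁻ x in 𝒳, ENNReal.ofReal (ρ x) = 1

/-- The law `ρ(x) dx` on `𝒳` of a single covariate. -/
def covLaw (𝒳 : Set (EuclideanSpace ℝ (Fin d))) (ρ : EuclideanSpace ℝ (Fin d) → ℝ) :
    Measure (EuclideanSpace ℝ (Fin d)) :=
  (volume.restrict 𝒳).withDensity fun x => ENNReal.ofReal (ρ x)

/-- `K` is a (measurable) positive definite correlation function on `𝒳`: it is symmetric, all its
finite Gram matrices are positive semidefinite, and `K(x, x) = 1`. -/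
structure IsCorrelationKernel (𝒳 : Set (EuclideanSpace ℝ (Fin d)))
    (K : EuclideanSpace ℝ (Fin d) → EuclideanSpace ℝ (Fin d) → ℝ) : Prop where
  measurable : Measurable (Function.uncurry K)
  posSemidef : (Matrix.of fun x y : 𝒳 => K x y).PosSemidef
  diag : ∀ x ∈ 𝒳, K x x = 1

/-- `(φ_j)` are `L²_ρ`-orthonormal eigenfunctions of the kernel `K`, with non-negative eigenvalues
`(λ_j)`, relative to the covariate density `ρ`. Indices start at `0` rather than at `1`. -/
structure IsEigensystem (𝒳 : Set (EuclideanSpace ℝ (Fin d)))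
    (ρ : EuclideanSpace ℝ (Fin d) → ℝ)
    (K : EuclideanSpace ℝ (Fin d) → EuclideanSpace ℝ (Fin d) → ℝ)
    (φ : ℕ → EuclideanSpace ℝ (Fin d) → ℝ) (lam : ℕ → ℝ) : Prop where
  measurable : ∀ j, Measurable (φ j)
  memLp : ∀ j, MemLp (φ j) 2 (covLaw 𝒳 ρ)
  orthonormal : ∀ j l, ∫ x, φ j x * φ l x ∂(covLaw 𝒳 ρ) = if j = l then 1 else 0
  eigenvalue_nonneg : ∀ j, 0 ≤ lam j
  eigen : ∀ j, ∀ x ∈ 𝒳, ∫ x', K x x' * φ j x' ∂(covLaw 𝒳 ρ) = lam j * φ j x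

/-- The coefficient `θ₀ⱼ = ∫ f₀ φ_j ρ`. -/
def coef (𝒳 : Set (EuclideanSpace ℝ (Fin d))) (ρ : EuclideanSpace ℝ (Fin d) → ℝ)
    (φ : ℕ → EuclideanSpace ℝ (Fin d) → ℝ) (f₀ : EuclideanSpace ℝ (Fin d) → ℝ) (j : ℕ) : ℝ :=
  ∫ x, f₀ x * φ j x ∂(covLaw 𝒳 ρ)

/-- The truncation `f₀ᵗ` of the expansion of `f₀` after its first `k` terms. -/
def truncation (𝒳 : Set (EuclideanSpace ℝ (Fin d))) (ρ : EuclideanSpace ℝ (Fin d) → ℝ)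
    (φ : ℕ → EuclideanSpace ℝ (Fin d) → ℝ) (f₀ : EuclideanSpace ℝ (Fin d) → ℝ) (k : ℕ)
    (x : EuclideanSpace ℝ (Fin d)) : ℝ :=
  ∑ j ∈ Finset.range k, coef 𝒳 ρ φ f₀ j * φ j x

/-- The vector `θ₀ᵗ` of the first `k` coefficients of `f₀`. -/
def coefVec (𝒳 : Set (EuclideanSpace ℝ (Fin d))) (ρ : EuclideanSpace ℝ (Fin d) → ℝ)
    (φ : ℕ → EuclideanSpace ℝ (Fin d) → ℝ) (f₀ : EuclideanSpace ℝ (Fin d) → ℝ) (k : ℕ) :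
    EuclideanSpace ℝ (Fin k) :=
  WithLp.toLp 2 fun j => coef 𝒳 ρ φ f₀ j

/-- The squared RKHS norm `‖θ₀ᵗ‖²_ℍ = ∑_{j ≤ k} θ₀ⱼ² / λ_j`. -/
def rkhsNormSq (𝒳 : Set (EuclideanSpace ℝ (Fin d))) (ρ : EuclideanSpace ℝ (Fin d) → ℝ)
    (φ : ℕ → EuclideanSpace ℝ (Fin d) → ℝ) (lam : ℕ → ℝ) (f₀ : EuclideanSpace ℝ (Fin d) → ℝ)
    (k : ℕ) : ℝ :=
  ∑ j ∈ Finset.range k, coef 𝒳 ρ φ f₀ j ^ 2 / lam j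

/-- Assumption (T1): `f₀ ∈ L²_ρ(𝒳)`, and its expansion along `(φ_j)` converges to it in `L²_ρ`. -/
structure T1 (𝒳 : Set (EuclideanSpace ℝ (Fin d))) (ρ : EuclideanSpace ℝ (Fin d) → ℝ)
    (φ : ℕ → EuclideanSpace ℝ (Fin d) → ℝ) (f₀ : EuclideanSpace ℝ (Fin d) → ℝ) : Prop where
  measurable : Measurable f₀
  memLp : MemLp f₀ 2 (covLaw 𝒳 ρ)
  tendsto : Tendsto (fun J => eLpNorm (fun x => f₀ x - truncation 𝒳 ρ φ f₀ J x) 2 (covLaw 𝒳 ρ))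
    atTop (𝓝 0)

/-- `Λ = diag(λ_1, …, λ_k)`. -/
def Lam (lam : ℕ → ℝ) (k : ℕ) : Matrix (Fin k) (Fin k) ℝ :=
  Matrix.diagonal fun j => lam j

/-- Assumption (A1): `Λ` is invertible (its entries being positive) and `‖Λ⁻¹‖₂ < n / 4`. -/
def A1 (lam : ℕ → ℝ) (n k : ℕ) : Prop :=
  (∀ j < k, 0 < lam j) ∧ opNorm (Lam lam k)⁻¹ < n / 4

/-- Assumption (A2): the first `k` eigenfunctions are bounded by `L` on `𝒳`, and
`L² k log k < n`. -/
def A2 (𝒳 : Set (EuclideanSpace ℝ (Fin d))) (φ : ℕ → EuclideanSpace ℝ (Fin d) → ℝ) (L : ℝ)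
    (n k : ℕ) : Prop :=
  (∀ j < k, ∀ x ∈ 𝒳, |φ j x| ≤ L) ∧ L ^ 2 * k * Real.log k < n

/-- The `n × k` design matrix `Φ = (φ_j(X_i))`. -/
def design (φ : ℕ → EuclideanSpace ℝ (Fin d) → ℝ) {n : ℕ} (k : ℕ)
    (X : Fin n → EuclideanSpace ℝ (Fin d)) : Matrix (Fin n) (Fin k) ℝ :=
  Matrix.of fun i j => φ j (X i)

/-- The event `A_n = {‖ΦᵀΦ - n I‖₂ < n / 2}`, as a set of design points. -/
def goodSet (φ : ℕ → EuclideanSpace ℝ (Fin d) → ℝ) (n k : ℕ) :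
    Set (Fin n → EuclideanSpace ℝ (Fin d)) :=
  {X | opNorm ((design φ k X)ᵀ * design φ k X - (n : ℝ) • (1 : Matrix (Fin k) (Fin k) ℝ)) < n / 2}

/-- The posterior mean `θ̃ = (ΦᵀΦ + Λ⁻¹)⁻¹ Φᵀ Y`. -/
def postMean (φ : ℕ → EuclideanSpace ℝ (Fin d) → ℝ) (lam : ℕ → ℝ) {n : ℕ} (k : ℕ)
    (X : Fin n → EuclideanSpace ℝ (Fin d)) (Y : Fin n → ℝ) : EuclideanSpace ℝ (Fin k) :=
  WithLp.toLp 2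
    (((design φ k X)ᵀ * design φ k X + (Lam lam k)⁻¹)⁻¹ *ᵥ ((design φ k X)ᵀ *ᵥ Y))

/-- The posterior covariance `Σ̃ = σ² (ΦᵀΦ + Λ⁻¹)⁻¹`. -/
def postCov (φ : ℕ → EuclideanSpace ℝ (Fin d) → ℝ) (lam : ℕ → ℝ) (σ : ℝ) {n : ℕ} (k : ℕ)
    (X : Fin n → EuclideanSpace ℝ (Fin d)) : Matrix (Fin k) (Fin k) ℝ :=
  σ ^ 2 • ((design φ k X)ᵀ * design φ k X + (Lam lam k)⁻¹)⁻¹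

/-- The tGP posterior `N(θ̃, Σ̃)` of the first `k` coefficients. -/
def posterior (φ : ℕ → EuclideanSpace ℝ (Fin d) → ℝ) (lam : ℕ → ℝ) (σ : ℝ) {n : ℕ} (k : ℕ)
    (X : Fin n → EuclideanSpace ℝ (Fin d)) (Y : Fin n → ℝ) : Measure (EuclideanSpace ℝ (Fin k)) :=
  multivariateGaussian (postMean φ lam k X Y) (postCov φ lam σ k X)

/-- The law of one observation `(X_1, Y_1)` under the truth: `X_1 ∼ ρ` and `Y_1 = f₀(X_1) + ε_1`,
with `ε_1 ∼ N(0, σ²)` independent of `X_1`. -/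
def obsLaw (𝒳 : Set (EuclideanSpace ℝ (Fin d))) (ρ : EuclideanSpace ℝ (Fin d) → ℝ)
    (f₀ : EuclideanSpace ℝ (Fin d) → ℝ) (σ : ℝ) : Measure (EuclideanSpace ℝ (Fin d) × ℝ) :=
  ((covLaw 𝒳 ρ).prod (gaussianReal 0 (Real.toNNReal (σ ^ 2)))).map
    fun p => (p.1, f₀ p.1 + p.2)

/-- The true joint law of the sample `((X_1, Y_1), …, (X_n, Y_n))`. -/
def trueLaw (𝒳 : Set (EuclideanSpace ℝ (Fin d))) (ρ : EuclideanSpace ℝ (Fin d) → ℝ)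
    (f₀ : EuclideanSpace ℝ (Fin d) → ℝ) (σ : ℝ) (n : ℕ) :
    Measure (Fin n → EuclideanSpace ℝ (Fin d) × ℝ) :=
  Measure.pi fun _ => obsLaw 𝒳 ρ f₀ σ

/-- `E₀ { 1_{A_n}(X) d_{W,2}²[ N(θ̃, Σ̃), N(θ₀ᵗ, (σ²/n) I) ] }`. -/
def risk (𝒳 : Set (EuclideanSpace ℝ (Fin d))) (ρ : EuclideanSpace ℝ (Fin d) → ℝ)
    (φ : ℕ → EuclideanSpace ℝ (Fin d) → ℝ) (lam : ℕ → ℝ) (f₀ : EuclideanSpace ℝ (Fin d) → ℝ)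
    (σ : ℝ) (n k : ℕ) : ℝ≥0∞ :=
  ∫⁻ z, (goodSet φ n k).indicator (fun _ => (1 : ℝ≥0∞)) (fun i => (z i).1) *
      wasserstein 2 (posterior φ lam σ k (fun i => (z i).1) (fun i => (z i).2))
        (multivariateGaussian (coefVec 𝒳 ρ φ f₀ k)
          ((σ ^ 2 / n) • (1 : Matrix (Fin k) (Fin k) ℝ))) ^ 2
    ∂(trueLaw 𝒳 ρ f₀ σ n)

end TGP

end

namespace TGP

/-! ### Quadratic forms and inverses of matrices -/

/-! Both covariances have trace of order `σ² k / n`, so no optimal coupling is needed: the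
independent one already gives `d² ≤ 3 (tr Σ̃ + σ² k / n + ‖θ̃ - θ₀‖²)`
(`wasserstein_multivariateGaussian_sq_le`).

On the good event the eigenvalues of `ΦᵀΦ` lie in `[n/2, 3n/2]`, hence `M = ΦᵀΦ + Λ⁻¹ ≥ n/2` and `tr
Σ̃ ≤ 2 σ² k / n`. Writing `Y = Φθ₀ + r + e`, with `r` the truncation residual at the design points
and `e` the noise, gives `θ̃ - θ₀ = M⁻¹(Φᵀr + Φᵀe - Λ⁻¹θ₀)`. Here `‖M⁻¹‖ ≤ 2/n`, `‖Φᵀr‖² ≤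
(3n/2)‖r‖²` and `‖Λ⁻¹θ₀‖² ≤ (n/4)‖θ₀‖²_ℍ` (`postMean_error_le`).

The resulting bound makes sense for every sample, so the indicator can be dropped before
integrating: `E‖r‖² = n ‖f₀ - f₀ᵗ‖²` and, by independence and orthonormality, `E‖Φᵀe‖² = n k σ²`
(`risk_le`). -/

theorem opNorm_nonneg {k : ℕ} (A : Matrix (Fin k) (Fin k) ℝ) : 0 ≤ opNorm A := norm_nonneg _

theorem norm_toLp_sq {ι : Type*} [Fintype ι] (v : ι → ℝ) :
    ‖(WithLp.toLp 2 v : EuclideanSpace ℝ ι)‖ ^ 2 = v ⬝ᵥ v := by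
  rw [EuclideanSpace.norm_sq_eq]
  simp [dotProduct, sq]

/-- The bridge from operator norms to quadratic forms, in terms of which the later matrix estimates
are phrased. -/
theorem abs_dotProduct_mulVec_le_opNorm {k : ℕ} (A : Matrix (Fin k) (Fin k) ℝ)
    (v : Fin k → ℝ) : |v ⬝ᵥ A *ᵥ v| ≤ opNorm A * (v ⬝ᵥ v) := by
  set x : EuclideanSpace ℝ (Fin k) := WithLp.toLp 2 v
  have h : v ⬝ᵥ A *ᵥ v = inner ℝ x (Matrix.toEuclideanCLM (n := Fin k) (𝕜 := ℝ) A x) := by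
    rw [Matrix.inner_toEuclideanCLM]
  rw [h, ← norm_toLp_sq v]
  calc _ ≤ ‖x‖ * ‖Matrix.toEuclideanCLM (n := Fin k) (𝕜 := ℝ) A x‖ := abs_real_inner_le_norm _ _
    _ ≤ ‖x‖ * (opNorm A * ‖x‖) := by
      gcongr
      exact ContinuousLinearMap.le_opNorm _ _
    _ = _ := by ring

theorem dotProduct_sq_le {ι : Type*} [Fintype ι] (v w : ι → ℝ) :
    (v ⬝ᵥ w) ^ 2 ≤ (v ⬝ᵥ v) * (w ⬝ᵥ w) := by
  have h := Finset.sum_mul_sq_le_sq_mul_sq Finset.univ v w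
  simpa [dotProduct, sq] using h

theorem dotProduct_self_nonneg' {ι : Type*} [Fintype ι] (v : ι → ℝ) : 0 ≤ v ⬝ᵥ v :=
  Finset.sum_nonneg fun i _ => mul_self_nonneg (v i)

/-- A symmetric matrix which is bounded below by `c > 0` is positive definite. -/
theorem posDef_of_coercive {k : ℕ} {M : Matrix (Fin k) (Fin k) ℝ} (hM : M.IsHermitian) {c : ℝ}
    (hc : 0 < c) (h : ∀ v, c * (v ⬝ᵥ v) ≤ v ⬝ᵥ M *ᵥ v) : M.PosDef := by
  refine Matrix.PosDef.of_dotProduct_mulVec_pos hM fun v hv => ?_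
  have h1 : 0 < v ⬝ᵥ v :=
    (dotProduct_self_nonneg' v).lt_of_ne fun h0 => hv (dotProduct_self_eq_zero.1 h0.symm)
  simpa using (mul_pos hc h1).trans_le (h v)

/-- The inverse of a matrix which is bounded below by `c > 0` is bounded by `1 / c`. -/
theorem inv_mulVec_dotProduct_self_le {k : ℕ} {M : Matrix (Fin k) (Fin k) ℝ}
    (hM : IsUnit M.det) {c : ℝ} (hc : 0 < c) (h : ∀ v, c * (v ⬝ᵥ v) ≤ v ⬝ᵥ M *ᵥ v)
    (w : Fin k → ℝ) : (M⁻¹ *ᵥ w) ⬝ᵥ (M⁻¹ *ᵥ w) ≤ (w ⬝ᵥ w) / c ^ 2 := by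
  set u := M⁻¹ *ᵥ w with hu
  have hw : M *ᵥ u = w := by
    rw [hu, Matrix.mulVec_mulVec, Matrix.mul_nonsing_inv _ hM, Matrix.one_mulVec]
  have h1 := h u
  rw [hw] at h1
  have h2 := dotProduct_sq_le u w
  have hu0 := dotProduct_self_nonneg' u
  rw [le_div_iff₀ (by positivity)]
  -- Cauchy–Schwarz turns `c |u|² ≤ u·w` into `c² |u|⁴ ≤ |u|² |w|²`; cancelling `|u|²` requires `u ≠
  -- 0`.
  rcases hu0.eq_or_lt with h0 | h0
  · rw [← h0]
    simpa using dotProduct_self_nonneg' w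
  · refine le_of_mul_le_mul_left ?_ h0
    calc _ = (c * (u ⬝ᵥ u)) ^ 2 := by ring
      _ ≤ (u ⬝ᵥ w) ^ 2 := by gcongr
      _ ≤ _ := h2

/-- Each diagonal entry of `M⁻¹` is a coordinate of the column `M⁻¹ eᵢ`, whose length is at most `1
/ c`. -/
theorem trace_inv_le {k : ℕ} {M : Matrix (Fin k) (Fin k) ℝ}
    (hM : IsUnit M.det) {c : ℝ} (hc : 0 < c) (h : ∀ v, c * (v ⬝ᵥ v) ≤ v ⬝ᵥ M *ᵥ v) :
    M⁻¹.trace ≤ k / c := by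
  have hi (i : Fin k) : M⁻¹ i i ≤ 1 / c := by
    have h1 := inv_mulVec_dotProduct_self_le hM hc h (Pi.single i 1)
    refine abs_le_of_sq_le_sq' (?_ : _ ≤ (1 / c) ^ 2) (by positivity) |>.2
    calc M⁻¹ i i ^ 2 ≤ (M⁻¹ *ᵥ Pi.single i 1) ⬝ᵥ (M⁻¹ *ᵥ Pi.single i 1) := by
          simp only [Matrix.mulVec_single_one, dotProduct, Matrix.col_apply, ← sq]
          exact Finset.single_le_sum (f := fun j => M⁻¹ j i ^ 2) (fun j _ => sq_nonneg _)
            (Finset.mem_univ i)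
      _ ≤ _ := h1
      _ = _ := by simp
  calc M⁻¹.trace ≤ ∑ _i : Fin k, 1 / c := Finset.sum_le_sum fun i _ => hi i
    _ = _ := by simp [div_eq_mul_inv]

theorem mulVec_dotProduct_mulVec {m k : ℕ} (Φ : Matrix (Fin m) (Fin k) ℝ) (v : Fin k → ℝ) :
    (Φ *ᵥ v) ⬝ᵥ (Φ *ᵥ v) = v ⬝ᵥ (Φᵀ * Φ) *ᵥ v := by
  rw [← Matrix.mulVec_mulVec, Matrix.dotProduct_mulVec v, Matrix.vecMul_transpose]

/-- An upper bound for `ΦᵀΦ` is one for `ΦΦᵀ`. -/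
theorem transpose_mulVec_dotProduct_self_le {m k : ℕ} {Φ : Matrix (Fin m) (Fin k) ℝ} {c : ℝ}
    (h : ∀ v, v ⬝ᵥ (Φᵀ * Φ) *ᵥ v ≤ c * (v ⬝ᵥ v)) (hc : 0 ≤ c) (r : Fin m → ℝ) :
    (Φᵀ *ᵥ r) ⬝ᵥ (Φᵀ *ᵥ r) ≤ c * (r ⬝ᵥ r) := by
  set u := Φᵀ *ᵥ r with hu
  -- Since `|u|² = r·Φu`, Cauchy–Schwarz gives `|u|⁴ ≤ |r|² |Φu|² ≤ c |r|² |u|²`.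
  have h1 : u ⬝ᵥ u = r ⬝ᵥ (Φ *ᵥ u) := by
    rw [hu, Matrix.dotProduct_mulVec r, Matrix.mulVec_transpose]
  have h2 := dotProduct_sq_le r (Φ *ᵥ u)
  rw [← h1, mulVec_dotProduct_mulVec Φ] at h2
  have h3 := h u
  have hr := dotProduct_self_nonneg' r
  rcases (dotProduct_self_nonneg' u).eq_or_lt with h0 | h0
  · rw [← h0]; positivity
  · refine le_of_mul_le_mul_left ?_ h0
    calc _ = (u ⬝ᵥ u) ^ 2 := by ring
      _ ≤ _ := h2
      _ ≤ (r ⬝ᵥ r) * (c * (u ⬝ᵥ u)) := by gcongr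
      _ = _ := by ring

theorem Lam_inv {lam : ℕ → ℝ} {k : ℕ} (h : ∀ j < k, 0 < lam j) :
    (Lam lam k)⁻¹ = Matrix.diagonal fun j : Fin k => (lam j)⁻¹ := by
  refine Matrix.inv_eq_right_inv ?_
  rw [Lam, Matrix.diagonal_mul_diagonal, ← Matrix.diagonal_one]
  congr 1
  ext j
  exact mul_inv_cancel₀ (h j j.2).ne'

theorem inv_lam_le_of_A1 {lam : ℕ → ℝ} {n k : ℕ} (h : A1 lam n k) (j : Fin k) :
    (lam j)⁻¹ ≤ n / 4 := by
  have h1 := abs_dotProduct_mulVec_le_opNorm (Lam lam k)⁻¹ (Pi.single j 1)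
  have h2 := h.2
  rw [Lam_inv h.1] at h1 h2
  simp only [Matrix.mulVec_single_one, single_one_dotProduct, Matrix.col_apply,
    Matrix.diagonal_apply_eq, Pi.single_eq_same, mul_one] at h1
  exact (le_abs_self _).trans (h1.trans h2.le)

/-- The strict bound on a nonnegative norm forces `n > 0`, even when `k = 0`. -/
theorem cast_pos_of_A1 {lam : ℕ → ℝ} {n k : ℕ} (h : A1 lam n k) : (0 : ℝ) < n := by
  have := (opNorm_nonneg _).trans_lt h.2
  linarith

/-- The matrix `ΦᵀΦ + Λ⁻¹`. -/
noncomputable def precision {d : ℕ} (φ : ℕ → EuclideanSpace ℝ (Fin d) → ℝ) (lam : ℕ → ℝ) {n : ℕ} (k : ℕ)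
    (X : Fin n → EuclideanSpace ℝ (Fin d)) : Matrix (Fin k) (Fin k) ℝ :=
  (design φ k X)ᵀ * design φ k X + (Lam lam k)⁻¹

/-! ### Deterministic bounds on the good event -/

section Good

variable {d n k : ℕ} {φ : ℕ → EuclideanSpace ℝ (Fin d) → ℝ} {lam : ℕ → ℝ}
  {X : Fin n → EuclideanSpace ℝ (Fin d)}

/-- The lower side makes the precision matrix coercive; the upper side controls `Φᵀr`. -/
theorem abs_gram_sub_le (hX : X ∈ goodSet φ n k) (v : Fin k → ℝ) :
    |v ⬝ᵥ ((design φ k X)ᵀ * design φ k X) *ᵥ v - n * (v ⬝ᵥ v)| ≤ n / 2 * (v ⬝ᵥ v) := by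
  have h := abs_dotProduct_mulVec_le_opNorm
    ((design φ k X)ᵀ * design φ k X - (n : ℝ) • (1 : Matrix (Fin k) (Fin k) ℝ)) v
  rw [Matrix.sub_mulVec, dotProduct_sub, Matrix.smul_mulVec, Matrix.one_mulVec,
    dotProduct_smul, smul_eq_mul] at h
  have hX' : opNorm _ < _ := hX
  exact h.trans (mul_le_mul_of_nonneg_right hX'.le (dotProduct_self_nonneg' v))

theorem precision_coercive (hlam : ∀ j < k, 0 < lam j) (hX : X ∈ goodSet φ n k)
    (v : Fin k → ℝ) : n / 2 * (v ⬝ᵥ v) ≤ v ⬝ᵥ precision φ lam k X *ᵥ v := by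
  have h := (abs_le.1 (abs_gram_sub_le hX v)).1
  have h2 : 0 ≤ v ⬝ᵥ (Lam lam k)⁻¹ *ᵥ v := by
    rw [Lam_inv hlam]
    simp only [dotProduct, Matrix.mulVec_diagonal]
    refine Finset.sum_nonneg fun j _ => ?_
    have := inv_pos.2 (hlam j j.2)
    nlinarith [mul_self_nonneg (v j)]
  rw [precision, Matrix.add_mulVec, dotProduct_add]
  linarith

theorem precision_posDef (hn : (0 : ℝ) < n) (hlam : ∀ j < k, 0 < lam j)
    (hX : X ∈ goodSet φ n k) : (precision φ lam k X).PosDef := by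
  refine posDef_of_coercive ?_ (half_pos hn) (precision_coercive hlam hX)
  rw [precision, Lam_inv hlam]
  exact (Matrix.isHermitian_conjTranspose_mul_self _).add
    (Matrix.isHermitian_diagonal _)

theorem isUnit_det_precision (hn : (0 : ℝ) < n) (hlam : ∀ j < k, 0 < lam j)
    (hX : X ∈ goodSet φ n k) : IsUnit (precision φ lam k X).det :=
  (precision_posDef hn hlam hX).det_pos.ne'.isUnit

theorem postCov_posSemidef (hn : (0 : ℝ) < n) (hlam : ∀ j < k, 0 < lam j)
    (hX : X ∈ goodSet φ n k) (σ : ℝ) : (postCov φ lam σ k X).PosSemidef :=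
  (precision_posDef hn hlam hX).inv.posSemidef.smul (sq_nonneg σ)

theorem trace_postCov_le (hn : (0 : ℝ) < n) (hlam : ∀ j < k, 0 < lam j)
    (hX : X ∈ goodSet φ n k) (σ : ℝ) : (postCov φ lam σ k X).trace ≤ 2 * (σ ^ 2 * (k / n)) := by
  have h := trace_inv_le (isUnit_det_precision hn hlam hX) (half_pos hn)
    (precision_coercive hlam hX)
  rw [postCov, Matrix.trace_smul, smul_eq_mul]
  calc _ ≤ σ ^ 2 * (k / (n / 2)) := mul_le_mul_of_nonneg_left h (sq_nonneg σ)
    _ = _ := by field_simp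

/-- The error of the posterior mean splits into a regularization, a truncation and a noise term. -/
theorem postMean_sub_eq (hM : IsUnit (precision φ lam k X).det) (θ : Fin k → ℝ) (r e : Fin n → ℝ) :
    (precision φ lam k X)⁻¹ *ᵥ ((design φ k X)ᵀ *ᵥ (design φ k X *ᵥ θ + r + e)) - θ =
      (precision φ lam k X)⁻¹ *ᵥ
        ((design φ k X)ᵀ *ᵥ r + (design φ k X)ᵀ *ᵥ e - (Lam lam k)⁻¹ *ᵥ θ) := by
  have h : θ = (precision φ lam k X)⁻¹ *ᵥ (precision φ lam k X *ᵥ θ) := by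
    rw [Matrix.mulVec_mulVec, Matrix.nonsing_inv_mul _ hM, Matrix.one_mulVec]
  -- Only the subtracted `θ` becomes `M⁻¹Mθ`; then `M⁻¹` factors out and `ΦᵀΦθ` cancels, leaving
  -- `-Λ⁻¹θ`.
  nth_rw 2 [h]
  rw [← Matrix.mulVec_sub]
  congr 1
  rw [precision, Matrix.add_mulVec, ← Matrix.mulVec_mulVec, Matrix.mulVec_add, Matrix.mulVec_add]
  abel

theorem dotProduct_add_sub_self_le {ι : Type*} [Fintype ι] (a b c : ι → ℝ) :
    (a + b - c) ⬝ᵥ (a + b - c) ≤ 3 * (a ⬝ᵥ a + b ⬝ᵥ b + c ⬝ᵥ c) := by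
  simp only [dotProduct, ← Finset.sum_add_distrib, Finset.mul_sum, Pi.add_apply, Pi.sub_apply]
  refine Finset.sum_le_sum fun i _ => ?_
  nlinarith [sq_nonneg (a i - b i), sq_nonneg (a i + c i), sq_nonneg (b i + c i)]

/-- Of the two factors `λⱼ⁻¹` in each term, one is bounded by `n / 4` and the other is kept for the
RKHS norm. -/
theorem Lam_inv_mulVec_dotProduct_self_le (h : A1 lam n k) (θ : ℕ → ℝ) :
    ((Lam lam k)⁻¹ *ᵥ fun j : Fin k => θ j) ⬝ᵥ ((Lam lam k)⁻¹ *ᵥ fun j : Fin k => θ j) ≤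
      n / 4 * ∑ j ∈ Finset.range k, θ j ^ 2 / lam j := by
  rw [Lam_inv h.1, Finset.sum_range, Finset.mul_sum, dotProduct]
  refine Finset.sum_le_sum fun j _ => ?_
  have h1 := inv_lam_le_of_A1 h j
  have h2 := inv_pos.2 (h.1 j j.2)
  rw [Matrix.mulVec_diagonal, div_eq_mul_inv (θ j ^ 2)]
  have : 0 ≤ θ j ^ 2 * (lam j)⁻¹ := by positivity
  calc _ = (lam j)⁻¹ * (θ j ^ 2 * (lam j)⁻¹) := by ring
    _ ≤ _ := by gcongr

/-- On the good event, the squared error of the posterior mean is controlled by the RKHS norm of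
the truth, the truncation residual `r` and the noise `e`. -/
theorem postMean_error_le (h : A1 lam n k) (hX : X ∈ goodSet φ n k) (θ : ℕ → ℝ)
    (Y r e : Fin n → ℝ) (hY : Y = (design φ k X *ᵥ fun j => θ j) + r + e) :
    ‖postMean φ lam k X Y - WithLp.toLp 2 (fun j : Fin k => θ j)‖ ^ 2 ≤
      18 / n * (r ⬝ᵥ r) +
        12 / n ^ 2 * (((design φ k X)ᵀ *ᵥ e) ⬝ᵥ ((design φ k X)ᵀ *ᵥ e)) +
        3 * ((∑ j ∈ Finset.range k, θ j ^ 2 / lam j) / n) := by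
  have hn := cast_pos_of_A1 h
  have hU := isUnit_det_precision hn h.1 hX
  have h1 : postMean φ lam k X Y - WithLp.toLp 2 (fun j : Fin k => θ j) =
      WithLp.toLp 2 ((precision φ lam k X)⁻¹ *ᵥ ((design φ k X)ᵀ *ᵥ Y) - fun j : Fin k => θ j) := rfl
  rw [h1, norm_toLp_sq, hY, postMean_sub_eq hU]
  refine (inv_mulVec_dotProduct_self_le hU (half_pos hn) (precision_coercive h.1 hX) _).trans ?_
  have h2 := dotProduct_add_sub_self_le ((design φ k X)ᵀ *ᵥ r) ((design φ k X)ᵀ *ᵥ e)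
    ((Lam lam k)⁻¹ *ᵥ fun j : Fin k => θ j)
  have h3 : ((design φ k X)ᵀ *ᵥ r) ⬝ᵥ ((design φ k X)ᵀ *ᵥ r) ≤ 3 * n / 2 * (r ⬝ᵥ r) := by
    refine transpose_mulVec_dotProduct_self_le (fun v => ?_) (by positivity) r
    have := (abs_le.1 (abs_gram_sub_le hX v)).2
    linarith
  have h4 := Lam_inv_mulVec_dotProduct_self_le h θ
  -- Division by `(n/2)²` yields `18 = 3·(3/2)·4`, `12 = 3·4` and `3 = 3·(1/4)·4`.
  rw [div_le_iff₀ (by positivity)]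
  refine h2.trans ((mul_le_mul_of_nonneg_left (add_le_add_three h3 le_rfl h4)
    (by norm_num)).trans (le_of_eq ?_))
  field_simp
  ring

end Good

end TGP

namespace TGP

/-! ### The Wasserstein distance between Gaussian measures -/

/-- The `i`-th coordinate has law `N(mᵢ, Sᵢᵢ)`, so the squared deviations add up to the sum of the
variances. -/
theorem lintegral_enorm_sub_sq_multivariateGaussian {k : ℕ} (m : EuclideanSpace ℝ (Fin k))
    {S : Matrix (Fin k) (Fin k) ℝ} (hS : S.PosSemidef) :
    ∫⁻ x, ‖x - m‖ₑ ^ 2 ∂(multivariateGaussian m S) = ENNReal.ofReal S.trace := by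
  have h1 (i : Fin k) :
      ∫⁻ x, ‖x i - m i‖ₑ ^ 2 ∂(multivariateGaussian m S) = ENNReal.ofReal (S i i) := by
    have hP := measurePreserving_eval_multivariateGaussian (μ := m) hS (i := i)
    rw [hP.lintegral_comp (f := fun y => ‖y - m i‖ₑ ^ 2) (by fun_prop)]
    have h2 := (memLp_id_gaussianReal (μ := m i) (v := (S i i).toNNReal) 2).ofReal_variance_eq
    rw [variance_id_gaussianReal, evariance] at h2
    simpa only [id_eq, integral_id_gaussianReal, Real.coe_toNNReal _ hS.diag_nonneg] using h2.symm
  have h2 (x : EuclideanSpace ℝ (Fin k)) : ‖x - m‖ₑ ^ 2 = ∑ i, ‖x i - m i‖ₑ ^ 2 := by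
    rw [← ofReal_norm, ← ENNReal.ofReal_pow (norm_nonneg _), EuclideanSpace.norm_sq_eq,
      ENNReal.ofReal_sum_of_nonneg fun _ _ => by positivity]
    refine Finset.sum_congr rfl fun i _ => ?_
    rw [ENNReal.ofReal_pow (norm_nonneg _), ofReal_norm, PiLp.sub_apply]
  simp_rw [h2]
  rw [lintegral_finsetSum _ fun i _ => by fun_prop, Matrix.trace,
    ENNReal.ofReal_sum_of_nonneg (f := S.diag) fun i _ => hS.diag_nonneg]
  exact Finset.sum_congr rfl fun i _ => h1 i

/-- The product measure is one admissible coupling. -/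
theorem wasserstein_two_sq_le {k : ℕ} (P Q : Measure (EuclideanSpace ℝ (Fin k)))
    [IsProbabilityMeasure P] [IsProbabilityMeasure Q] :
    wasserstein 2 P Q ^ 2 ≤ ∫⁻ z, ‖z.1 - z.2‖ₑ ^ 2 ∂(P.prod Q) := by
  have h : wasserstein 2 P Q ≤ (∫⁻ z, ‖z.1 - z.2‖ₑ ^ (2 : ℝ) ∂(P.prod Q)) ^ (1 / (2 : ℝ)) :=
    iInf_le_of_le (P.prod Q) (iInf_le_of_le (by simp [Measure.map_fst_prod])
      (iInf_le_of_le (by simp [Measure.map_snd_prod]) le_rfl))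
  simp_rw [ENNReal.rpow_two] at h
  calc _ ≤ ((∫⁻ z, ‖z.1 - z.2‖ₑ ^ 2 ∂(P.prod Q)) ^ (1 / (2 : ℝ))) ^ 2 := by gcongr
    _ = _ := by rw [← ENNReal.rpow_two, ← ENNReal.rpow_mul]; norm_num

theorem enorm_sub_sq_le {E : Type*} [NormedAddCommGroup E] (x y a b : E) :
    ‖x - y‖ₑ ^ 2 ≤ 3 * (‖x - a‖ₑ ^ 2 + ‖y - b‖ₑ ^ 2 + ‖a - b‖ₑ ^ 2) := by
  have h : ‖x - y‖ ≤ ‖x - a‖ + ‖y - b‖ + ‖a - b‖ := by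
    calc ‖x - y‖ = ‖(x - a) - (y - b) + (a - b)‖ := by congr 1; abel
      _ ≤ _ := (norm_add_le _ _).trans (add_le_add_left (norm_sub_le _ _) _)
  have h2 : ‖x - y‖ ^ 2 ≤ 3 * (‖x - a‖ ^ 2 + ‖y - b‖ ^ 2 + ‖a - b‖ ^ 2) := by
    have := pow_le_pow_left₀ (norm_nonneg _) h 2
    nlinarith [sq_nonneg (‖x - a‖ - ‖y - b‖), sq_nonneg (‖x - a‖ - ‖a - b‖),
      sq_nonneg (‖y - b‖ - ‖a - b‖)]
  have h3 := ENNReal.ofReal_le_ofReal h2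
  rw [ENNReal.ofReal_mul (by norm_num), ENNReal.ofReal_add (by positivity) (by positivity),
    ENNReal.ofReal_add (by positivity) (by positivity)] at h3
  simpa only [ENNReal.ofReal_pow (norm_nonneg _), ofReal_norm, ENNReal.ofReal_ofNat] using h3

theorem wasserstein_multivariateGaussian_sq_le {k : ℕ} (a b : EuclideanSpace ℝ (Fin k))
    {S T : Matrix (Fin k) (Fin k) ℝ} (hS : S.PosSemidef) (hT : T.PosSemidef) :
    wasserstein 2 (multivariateGaussian a S) (multivariateGaussian b T) ^ 2 ≤
      ENNReal.ofReal (3 * (S.trace + T.trace + ‖a - b‖ ^ 2)) := by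
  refine (wasserstein_two_sq_le _ _).trans ?_
  have h0 (z : EuclideanSpace ℝ (Fin k) × EuclideanSpace ℝ (Fin k)) :
      ‖z.1 - z.2‖ₑ ^ 2 ≤ 3 * (‖z.1 - a‖ₑ ^ 2 + ‖z.2 - b‖ₑ ^ 2 + ‖a - b‖ₑ ^ 2) :=
    enorm_sub_sq_le z.1 z.2 a b
  refine (lintegral_mono h0).trans (le_of_eq ?_)
  have h1 : ∫⁻ z, ‖z.1 - a‖ₑ ^ 2 ∂((multivariateGaussian a S).prod (multivariateGaussian b T)) =
      ENNReal.ofReal S.trace := by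
    rw [← lintegral_enorm_sub_sq_multivariateGaussian a hS]
    exact measurePreserving_fst.lintegral_comp (f := fun x => ‖x - a‖ₑ ^ 2) (by fun_prop)
  have h2 : ∫⁻ z, ‖z.2 - b‖ₑ ^ 2 ∂((multivariateGaussian a S).prod (multivariateGaussian b T)) =
      ENNReal.ofReal T.trace := by
    rw [← lintegral_enorm_sub_sq_multivariateGaussian b hT]
    exact measurePreserving_snd.lintegral_comp (f := fun x => ‖x - b‖ₑ ^ 2) (by fun_prop)
  rw [lintegral_const_mul _ (by fun_prop), lintegral_add_left (by fun_prop),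
    lintegral_add_left (by fun_prop), h1, h2, ENNReal.ofReal_mul (by norm_num),
    ENNReal.ofReal_add (add_nonneg hS.trace_nonneg hT.trace_nonneg) (by positivity),
    ENNReal.ofReal_add hS.trace_nonneg hT.trace_nonneg, ENNReal.ofReal_pow (norm_nonneg _),
    ofReal_norm, lintegral_const, measure_univ, mul_one, ENNReal.ofReal_ofNat]

end TGP

namespace TGP

/-! ### Expectations under the law of the sample -/

section Sampling

variable {d n k : ℕ} {𝒳 : Set (EuclideanSpace ℝ (Fin d))} {ρ : EuclideanSpace ℝ (Fin d) → ℝ}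
  {f₀ : EuclideanSpace ℝ (Fin d) → ℝ} {σ : ℝ}

theorem IsDensityOn.isProbabilityMeasure_covLaw (hρ : IsDensityOn 𝒳 ρ) :
    IsProbabilityMeasure (covLaw 𝒳 ρ) :=
  ⟨by rw [covLaw, withDensity_apply _ MeasurableSet.univ, Measure.restrict_univ,
    hρ.lintegral_eq_one]⟩

theorem measurable_obs (hf : Measurable f₀) :
    Measurable fun p : EuclideanSpace ℝ (Fin d) × ℝ => (p.1, f₀ p.1 + p.2) := by
  fun_prop

theorem isProbabilityMeasure_obsLaw (hρ : IsDensityOn 𝒳 ρ) (hf : Measurable f₀) :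
    IsProbabilityMeasure (obsLaw 𝒳 ρ f₀ σ) := by
  have := hρ.isProbabilityMeasure_covLaw
  exact Measure.isProbabilityMeasure_map (measurable_obs hf).aemeasurable

theorem measurePreserving_fst_obsLaw (hf : Measurable f₀) :
    MeasurePreserving Prod.fst (obsLaw 𝒳 ρ f₀ σ) (covLaw 𝒳 ρ) := by
  refine ⟨measurable_fst, ?_⟩
  rw [obsLaw, Measure.map_map measurable_fst (measurable_obs hf)]
  exact Measure.map_fst_prod.trans (by simp)

theorem measurePreserving_covariate (hρ : IsDensityOn 𝒳 ρ) (hf : Measurable f₀) (i : Fin n) :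
    MeasurePreserving (fun z : Fin n → EuclideanSpace ℝ (Fin d) × ℝ => (z i).1)
      (trueLaw 𝒳 ρ f₀ σ n) (covLaw 𝒳 ρ) := by
  have := isProbabilityMeasure_obsLaw (σ := σ) hρ hf
  exact (measurePreserving_fst_obsLaw hf).comp (measurePreserving_eval _ i)

theorem integrable_sum_sq_covariates (hρ : IsDensityOn 𝒳 ρ) (hf : Measurable f₀)
    {r : EuclideanSpace ℝ (Fin d) → ℝ} (hr : MemLp r 2 (covLaw 𝒳 ρ)) :
    Integrable (fun z : Fin n → EuclideanSpace ℝ (Fin d) × ℝ => ∑ i, r (z i).1 ^ 2)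
      (trueLaw 𝒳 ρ f₀ σ n) :=
  integrable_finsetSum _ fun i _ =>
    (measurePreserving_covariate hρ hf i).integrable_comp_of_integrable hr.integrable_sq

theorem integral_sum_sq_covariates (hρ : IsDensityOn 𝒳 ρ) (hf : Measurable f₀)
    {r : EuclideanSpace ℝ (Fin d) → ℝ} (hr : MemLp r 2 (covLaw 𝒳 ρ)) :
    ∫ z, ∑ i, r (z i).1 ^ 2 ∂(trueLaw 𝒳 ρ f₀ σ n) = n * ∫ x, r x ^ 2 ∂(covLaw 𝒳 ρ) := by
  have h (i : Fin n) : ∫ z, r (z i).1 ^ 2 ∂(trueLaw 𝒳 ρ f₀ σ n) =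
      ∫ x, r x ^ 2 ∂(covLaw 𝒳 ρ) := by
    have hm := measurePreserving_covariate (σ := σ) hρ hf i
    rw [← hm.map_eq, integral_map hm.aemeasurable]
    rw [hm.map_eq]
    exact hr.integrable_sq.aestronglyMeasurable
  refine (integral_finsetSum _ fun i _ => (measurePreserving_covariate hρ hf
    i).integrable_comp_of_integrable hr.integrable_sq).trans ?_
  exact (Finset.sum_congr rfl fun i _ => h i).trans (by simp)

/-! ### Second moments of the noise weighted by a function of the covariate -/

section Noise

variable {φ : EuclideanSpace ℝ (Fin d) → ℝ}

theorem measurable_mul_noise (hf : Measurable f₀) (hφ : Measurable φ) :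
    Measurable fun p : EuclideanSpace ℝ (Fin d) × ℝ => φ p.1 * (p.2 - f₀ p.1) := by
  fun_prop

/-- Pulled back to the product measure, `y - f₀ x` is the noise coordinate, so the square factors
into integrable functions of independent variables. -/
theorem memLp_mul_noise (hρ : IsDensityOn 𝒳 ρ) (hf : Measurable f₀) (hφ : Measurable φ)
    (hφ2 : MemLp φ 2 (covLaw 𝒳 ρ)) :
    MemLp (fun p => φ p.1 * (p.2 - f₀ p.1)) 2 (obsLaw 𝒳 ρ f₀ σ) := by
  have := hρ.isProbabilityMeasure_covLaw
  have hm := measurable_mul_noise hf hφ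
  rw [memLp_two_iff_integrable_sq hm.aestronglyMeasurable, obsLaw,
    integrable_map_measure (hm.pow_const 2).aestronglyMeasurable (measurable_obs hf).aemeasurable]
  refine (hφ2.integrable_sq.mul_prod
    (memLp_id_gaussianReal (μ := 0) (v := (σ ^ 2).toNNReal) 2).integrable_sq).congr
    (ae_of_all _ fun p => ?_)
  simp [mul_pow]

theorem integral_mul_noise (hf : Measurable f₀) (hφ : Measurable φ) :
    ∫ p, φ p.1 * (p.2 - f₀ p.1) ∂(obsLaw 𝒳 ρ f₀ σ) = 0 := by
  rw [obsLaw, integral_map (measurable_obs hf).aemeasurable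
    (measurable_mul_noise hf hφ).aestronglyMeasurable]
  simp only [add_sub_cancel_left]
  have : SFinite (covLaw 𝒳 ρ) := by unfold covLaw; infer_instance
  rw [integral_prod_mul φ fun e : ℝ => e]
  simp

theorem integral_mul_noise_sq (hf : Measurable f₀) (hφ : Measurable φ) :
    ∫ p, (φ p.1 * (p.2 - f₀ p.1)) ^ 2 ∂(obsLaw 𝒳 ρ f₀ σ) =
      σ ^ 2 * ∫ x, φ x ^ 2 ∂(covLaw 𝒳 ρ) := by
  rw [obsLaw, integral_map (measurable_obs hf).aemeasurable
    ((measurable_mul_noise hf hφ).pow_const 2).aestronglyMeasurable]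
  simp only [add_sub_cancel_left, mul_pow]
  have : SFinite (covLaw 𝒳 ρ) := by unfold covLaw; infer_instance
  rw [integral_prod_mul (fun x => φ x ^ 2) fun e : ℝ => e ^ 2, mul_comm]
  congr 1
  have h := variance_of_integral_eq_zero (μ := gaussianReal 0 (σ ^ 2).toNNReal) (X := fun x => x)
    aemeasurable_id (by simp)
  rw [← h, variance_fun_id_gaussianReal, Real.coe_toNNReal _ (sq_nonneg σ)]

theorem memLp_mul_noise_eval (hρ : IsDensityOn 𝒳 ρ) (hf : Measurable f₀) (hφ : Measurable φ)
    (hφ2 : MemLp φ 2 (covLaw 𝒳 ρ)) (i : Fin n) :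
    MemLp (fun z : Fin n → EuclideanSpace ℝ (Fin d) × ℝ => φ (z i).1 * ((z i).2 - f₀ (z i).1)) 2
      (trueLaw 𝒳 ρ f₀ σ n) := by
  have := isProbabilityMeasure_obsLaw (σ := σ) hρ hf
  exact (memLp_mul_noise hρ hf hφ hφ2).comp_measurePreserving (measurePreserving_eval _ i)

theorem integrable_sum_mul_noise_sq (hρ : IsDensityOn 𝒳 ρ) (hf : Measurable f₀)
    (hφ : Measurable φ) (hφ2 : MemLp φ 2 (covLaw 𝒳 ρ)) :
    Integrable (fun z : Fin n → EuclideanSpace ℝ (Fin d) × ℝ =>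
      (∑ i, φ (z i).1 * ((z i).2 - f₀ (z i).1)) ^ 2) (trueLaw 𝒳 ρ f₀ σ n) :=
  (memLp_finsetSum _ fun i _ => memLp_mul_noise_eval hρ hf hφ hφ2 i).integrable_sq

/-- The summands are centred and independent, so the second moment is a variance and variances add.
-/
theorem integral_sum_mul_noise_sq (hρ : IsDensityOn 𝒳 ρ) (hf : Measurable f₀)
    (hφ : Measurable φ) (hφ2 : MemLp φ 2 (covLaw 𝒳 ρ)) :
    ∫ z, (∑ i, φ (z i).1 * ((z i).2 - f₀ (z i).1)) ^ 2 ∂(trueLaw 𝒳 ρ f₀ σ n) =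
      n * (σ ^ 2 * ∫ x, φ x ^ 2 ∂(covLaw 𝒳 ρ)) := by
  have := isProbabilityMeasure_obsLaw (σ := σ) hρ hf
  have : IsProbabilityMeasure (trueLaw 𝒳 ρ f₀ σ n) := by unfold trueLaw; infer_instance
  have hL := memLp_mul_noise (σ := σ) hρ hf hφ hφ2
  have hmean (i : Fin n) :
      ∫ z, φ (z i).1 * ((z i).2 - f₀ (z i).1) ∂(trueLaw 𝒳 ρ f₀ σ n) = 0 :=
    (integral_comp_eval (μ := fun _ : Fin n => obsLaw 𝒳 ρ f₀ σ)
      hL.aestronglyMeasurable).trans (integral_mul_noise hf hφ)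
  have h1 := variance_sum_pi (μ := fun _ : Fin n => obsLaw 𝒳 ρ f₀ σ)
    (X := fun _ p => φ p.1 * (p.2 - f₀ p.1)) fun _ => hL
  rw [variance_of_integral_eq_zero] at h1
  · simp only [Finset.sum_apply, variance_of_integral_eq_zero hL.aemeasurable
      (integral_mul_noise hf hφ), integral_mul_noise_sq hf hφ] at h1
    simpa [trueLaw] using h1
  · exact Finset.aemeasurable_sum _ fun i _ =>
      (memLp_mul_noise_eval (n := n) (σ := σ) hρ hf hφ hφ2 i).aemeasurable
  · simp only [Finset.sum_apply]
    refine (integral_finsetSum _ fun i _ =>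
      (memLp_mul_noise_eval (n := n) (σ := σ) hρ hf hφ hφ2 i).integrable one_le_two).trans ?_
    exact Finset.sum_eq_zero fun i _ => hmean i

end Noise

end Sampling

end TGP

namespace TGP

/-! ### The risk bound -/

section Risk

variable {d n k : ℕ} {𝒳 : Set (EuclideanSpace ℝ (Fin d))} {ρ : EuclideanSpace ℝ (Fin d) → ℝ}
  {K : EuclideanSpace ℝ (Fin d) → EuclideanSpace ℝ (Fin d) → ℝ}
  {φ : ℕ → EuclideanSpace ℝ (Fin d) → ℝ} {lam : ℕ → ℝ}
  {f₀ : EuclideanSpace ℝ (Fin d) → ℝ} {σ : ℝ}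

theorem memLp_residual (hφ : IsEigensystem 𝒳 ρ K φ lam) (hf : MemLp f₀ 2 (covLaw 𝒳 ρ)) :
    MemLp (fun x => f₀ x - truncation 𝒳 ρ φ f₀ k x) 2 (covLaw 𝒳 ρ) :=
  hf.sub (memLp_finsetSum _ fun j _ => (hφ.memLp j).const_mul _)

/-- A pointwise bound for the Wasserstein loss on the good event. -/
theorem wasserstein_posterior_sq_le (h : A1 lam n k) {X : Fin n → EuclideanSpace ℝ (Fin d)}
    (hX : X ∈ goodSet φ n k) (Y : Fin n → ℝ) :
    wasserstein 2 (posterior φ lam σ k X Y) (multivariateGaussian (coefVec 𝒳 ρ φ f₀ k)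
        ((σ ^ 2 / n) • (1 : Matrix (Fin k) (Fin k) ℝ))) ^ 2 ≤
      ENNReal.ofReal (9 * (σ ^ 2 * (k / n)) + 9 * (rkhsNormSq 𝒳 ρ φ lam f₀ k / n) +
        54 / n * ∑ i, (f₀ (X i) - truncation 𝒳 ρ φ f₀ k (X i)) ^ 2 +
        36 / n ^ 2 * ∑ j ∈ Finset.range k, (∑ i, φ j (X i) * (Y i - f₀ (X i))) ^ 2) := by
  have hn := cast_pos_of_A1 h
  refine (wasserstein_multivariateGaussian_sq_le _ _ (postCov_posSemidef hn h.1 hX σ)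
    (Matrix.PosSemidef.one.smul (by positivity))).trans (ENNReal.ofReal_le_ofReal ?_)
  have h1 := trace_postCov_le hn h.1 hX σ
  have h2 : ((σ ^ 2 / n) • (1 : Matrix (Fin k) (Fin k) ℝ)).trace = σ ^ 2 * (k / n) := by
    simp [Matrix.trace_smul]
    ring
  have h3 := postMean_error_le h hX (coef 𝒳 ρ φ f₀) Y
    (fun i => f₀ (X i) - truncation 𝒳 ρ φ f₀ k (X i)) (fun i => Y i - f₀ (X i)) (by
      ext i
      simp only [Pi.add_apply, Matrix.mulVec, dotProduct, design, Matrix.of_apply, truncation,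
        Finset.sum_range, mul_comm (φ _ (X i))]
      ring)
  have h4 : ((fun i => f₀ (X i) - truncation 𝒳 ρ φ f₀ k (X i)) ⬝ᵥ
      fun i => f₀ (X i) - truncation 𝒳 ρ φ f₀ k (X i)) =
      ∑ i, (f₀ (X i) - truncation 𝒳 ρ φ f₀ k (X i)) ^ 2 := by
    simp only [dotProduct, sq]
  have h5 : ((design φ k X)ᵀ *ᵥ fun i => Y i - f₀ (X i)) ⬝ᵥ
      ((design φ k X)ᵀ *ᵥ fun i => Y i - f₀ (X i)) =
      ∑ j ∈ Finset.range k, (∑ i, φ j (X i) * (Y i - f₀ (X i))) ^ 2 := by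
    rw [Finset.sum_range]
    simp only [dotProduct, Matrix.mulVec, design, Matrix.transpose_apply, Matrix.of_apply, sq]
  rw [h4, h5] at h3
  rw [h2]
  -- The factor 3 multiplies the traces `2 + 1` and the mean-error constants `18`, `12`, `3`.
  refine (mul_le_mul_of_nonneg_left (add_le_add (add_le_add_left h1 _) h3)
    (by norm_num)).trans (le_of_eq ?_)
  rw [rkhsNormSq]
  ring

theorem risk_le (hρ : IsDensityOn 𝒳 ρ) (hφ : IsEigensystem 𝒳 ρ K φ lam) (hf : Measurable f₀)
    (hf2 : MemLp f₀ 2 (covLaw 𝒳 ρ)) (h : A1 lam n k) :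
    risk 𝒳 ρ φ lam f₀ σ n k ≤
      ENNReal.ofReal (45 * (σ ^ 2 * (k / n)) + 9 * (rkhsNormSq 𝒳 ρ φ lam f₀ k / n) +
        54 * ∫ x, (f₀ x - truncation 𝒳 ρ φ f₀ k x) ^ 2 ∂(covLaw 𝒳 ρ)) := by
  have hn := cast_pos_of_A1 h
  have := isProbabilityMeasure_obsLaw (σ := σ) hρ hf
  have : IsProbabilityMeasure (trueLaw 𝒳 ρ f₀ σ n) := by unfold trueLaw; infer_instance
  set c : ℝ := 9 * (σ ^ 2 * (k / n)) + 9 * (rkhsNormSq 𝒳 ρ φ lam f₀ k / n) with hc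
  have hR0 : 0 ≤ rkhsNormSq 𝒳 ρ φ lam f₀ k := Finset.sum_nonneg fun j hj =>
    div_nonneg (sq_nonneg _) (hφ.eigenvalue_nonneg j)
  let G (z : Fin n → EuclideanSpace ℝ (Fin d) × ℝ) : ℝ :=
    c + 54 / n * ∑ i, (f₀ (z i).1 - truncation 𝒳 ρ φ f₀ k (z i).1) ^ 2 +
      36 / n ^ 2 * ∑ j ∈ Finset.range k, (∑ i, φ j (z i).1 * ((z i).2 - f₀ (z i).1)) ^ 2
  have hG0 (z) : 0 ≤ G z := by positivity
  have hi1 := (integrable_sum_sq_covariates (n := n) (σ := σ) hρ hf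
    (memLp_residual (k := k) hφ hf2)).const_mul (54 / (n : ℝ))
  have hi2 := fun j => integrable_sum_mul_noise_sq (n := n) (σ := σ) hρ hf (hφ.measurable j)
    (hφ.memLp j)
  have hi3 := (integrable_finsetSum (Finset.range k) fun j _ => hi2 j).const_mul
    (36 / (n : ℝ) ^ 2)
  have hi0 := (integrable_const (μ := trueLaw 𝒳 ρ f₀ σ n) c).add hi1
  have hG : Integrable G (trueLaw 𝒳 ρ f₀ σ n) := hi0.add hi3
  have hφ1 (j) : ∫ x, φ j x ^ 2 ∂(covLaw 𝒳 ρ) = 1 := by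
    simpa [sq] using hφ.orthonormal j j
  have hGint : ∫ z, G z ∂(trueLaw 𝒳 ρ f₀ σ n) =
      45 * (σ ^ 2 * (k / n)) + 9 * (rkhsNormSq 𝒳 ρ φ lam f₀ k / n) +
        54 * ∫ x, (f₀ x - truncation 𝒳 ρ φ f₀ k x) ^ 2 ∂(covLaw 𝒳 ρ) := by
    refine (integral_add hi0 hi3).trans ?_
    refine (congrArg (· + _) (integral_add (integrable_const c) hi1)).trans ?_
    -- Each of the `k` noise coordinates contributes `n σ²`, so the noise adds `36 σ² k / n` to the
    -- `9 σ² k / n` already in `c`.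
    rw [integral_const_mul, integral_const_mul, integral_sum_sq_covariates hρ hf
      (memLp_residual hφ hf2), integral_finsetSum _ fun j _ => hi2 j]
    simp only [integral_sum_mul_noise_sq hρ hf (hφ.measurable _) (hφ.memLp _), hφ1,
      integral_const, probReal_univ, Finset.sum_const, Finset.card_range, smul_eq_mul,
      nsmul_eq_mul, hc]
    field_simp
    ring
  rw [← hGint, ofReal_integral_eq_lintegral_ofReal hG (ae_of_all _ hG0), risk]
  -- Monotonicity of the lower integral is pointwise, so measurability of the good event or of the
  -- distance never enters.
  refine lintegral_mono fun z => ?_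
  by_cases hX : (fun i => (z i).1) ∈ goodSet φ n k
  · rw [Set.indicator_of_mem hX, one_mul]
    exact wasserstein_posterior_sq_le h hX _
  · rw [Set.indicator_of_notMem hX, zero_mul]
    exact zero_le

end Risk

end TGP

theorem mainTheorem2 :
    ∃ C : ℝ, 0 < C ∧
      ∀ (d n k : ℕ) (𝒳 : Set (EuclideanSpace ℝ (Fin d))) (ρ : EuclideanSpace ℝ (Fin d) → ℝ)
        (K : EuclideanSpace ℝ (Fin d) → EuclideanSpace ℝ (Fin d) → ℝ)
        (φ : ℕ → EuclideanSpace ℝ (Fin d) → ℝ) (lam : ℕ → ℝ)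
        (f₀ : EuclideanSpace ℝ (Fin d) → ℝ) (σ L : ℝ),
        0 < σ →
        TGP.IsDensityOn 𝒳 ρ →
        TGP.IsCorrelationKernel 𝒳 K →
        TGP.IsEigensystem 𝒳 ρ K φ lam →
        TGP.T1 𝒳 ρ φ f₀ →
        TGP.A1 lam n k →
        TGP.A2 𝒳 φ L n k →
        TGP.risk 𝒳 ρ φ lam f₀ σ n k ≤
          ENNReal.ofReal (C * (σ ^ 2 * (k / n) + TGP.rkhsNormSq 𝒳 ρ φ lam f₀ k / n
            + ∫ x, (f₀ x - TGP.truncation 𝒳 ρ φ f₀ k x) ^ 2 ∂(TGP.covLaw 𝒳 ρ))) := by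
  -- The largest of the constants `45`, `9`, `54` in `risk_le`.
  refine ⟨54, by norm_num, ?_⟩
  intro d n k 𝒳 ρ K φ lam f₀ σ L _ hρ _ hφ hf h _
  refine (TGP.risk_le hρ hφ hf.measurable hf.memLp h).trans (ENNReal.ofReal_le_ofReal ?_)
  have h1 : 0 ≤ σ ^ 2 * ((k : ℝ) / n) := by positivity
  have h2 : 0 ≤ TGP.rkhsNormSq 𝒳 ρ φ lam f₀ k / n :=
    div_nonneg (Finset.sum_nonneg fun j _ => div_nonneg (sq_nonneg _) (hφ.eigenvalue_nonneg j))
      n.cast_nonneg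
  linarith
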